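/- Let $n$ be a positive integer. For a group $H$ put $H^{(0)}=H$ and let $H^{(k+1)}=[H^{(k)},H^{(k)}]$ be the derived (commutator) subgroup of $H^{(k)}$. A group $G$ \emph{can be integrated $k$ times} if there is a group $H$ with $H^{(k)}\cong G$. The following are equivalent: (a) every group of order $n$ is abelian; (b) every group of order $n$ can be integrated twice; (c) every group of order $n$ can be integrated $k$ times, for every natural number $k$; (d) $n$ is cube-free (no integer $d>1$ satisfies $d^3\mid n$), and there are no prime divisors $p$ and $q$ of $n$ such that either $q\mid p-1$, or $q\mid p+1$ and $p^2\mid n$. -/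

import Mathlib

universe u

/-- `G` can be integrated `k` times: it is isomorphic to the `k`-th derived group of some group
(`derivedSeries H 0 = ⊤` and `derivedSeries H (k + 1) = ⁅derivedSeries H k, derivedSeries H k⁆`). -/
def CanBeIntegrated (G : Type u) [Group G] (k : ℕ) : Prop :=
  ∃ (H : Type u) (_ : Group H), Nonempty (derivedSeries H k ≃* G)

/-- `n` is cube-free: its only cube divisor is `1`. -/
def IsCubeFree (n : ℕ) : Prop := ∀ d : ℕ, d ^ 3 ∣ n → d = 1

/-! (d) ⇒ (a): cube-freeness makes each nontrivial Sylow subgroup P of order p or p², hence abelian,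
and the divisibility conditions force its normalizer to act trivially on it. Burnside's transfer
then has a kernel of order prime to p that contains G', so no prime divides |G'|
(`mul_comm_of_card_cubeFree`).

(a) ⇒ (c): a finite abelian group is the additive group of a commutative ring, and over that ring
the unitriangular group of size 2^k + 1 has its k-th derived group concentrated in the corner entry,
because commutators double the depth above the diagonal (`nonempty_derivedSeries_unitriangular`).

(b) ⇒ (d): if G ≅ H'', then H acts on G by conjugation, so Inn G lies in Aut(G)''
(`conj_mem_derivedSeries_mulAut`). When (d) fails, some group of order n violates this: a dihedral
group if 8 ∣ n, the group ℤ/p²m ⋊ ⟨1 + pm⟩ if p³ ∣ n with p odd, and otherwise a group of affine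
maps over a field of order p or p², times a cyclic group. In each of them Aut(G) acts on a suitable
piece through a group so close to abelian that Aut(G)'' misses an inner automorphism. -/

section

open Subgroup MulAction commutatorElement

/-! ### Sylow subgroups and Burnside transfer: the arithmetic condition forces commutativity. -/

/-- A `q`-group acting on a group of order `p` or `p ^ 2` by automorphisms acts trivially, under
the divisibility conditions that exclude elements of order `q` in the automorphism group. -/
theorem IsPGroup.smul_eq_self_of_card_prime_or_sq {Q P : Type*} [Group Q] [Group P] [Finite P]
    [MulDistribMulAction Q P] {p q : ℕ} (hp : p.Prime) (hq : q.Prime) (hQ : IsPGroup q Q)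
    (hqp : q ≠ p) (hcard : Nat.card P = p ∨ Nat.card P = p ^ 2) (h1 : ¬ q ∣ p - 1)
    (h2 : Nat.card P = p ^ 2 → ¬ q ∣ p + 1) (g : Q) (x : P) : g • x = x := by
  have := Fact.mk hq
  let F : Subgroup P :=
    { carrier := fixedPoints Q P
      mul_mem' := fun {a b} ha hb g => by rw [smul_mul', ha g, hb g]
      one_mem' := fun g => smul_one g
      inv_mem' := fun {a} ha g => by rw [smul_inv', ha g] }
  have hmod : Nat.card P ≡ Nat.card F [MOD q] := hQ.card_modEq_card_fixedPoints P
  have hdvd : Nat.card F ∣ Nat.card P := F.card_subgroup_dvd_card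
  have hp1 := hp.one_le
  have key : Nat.card F = Nat.card P := by
    have h1' : ¬ 1 ≡ p [MOD q] := fun h => h1 ((Nat.modEq_iff_dvd' hp1).1 h)
    rcases hcard with hc | hc
    · rcases (Nat.dvd_prime hp).1 (hc ▸ hdvd) with h | h
      · rw [hc, h] at hmod
        exact absurd hmod.symm h1'
      · rw [h, hc]
    · obtain ⟨k, hk, h⟩ := (Nat.dvd_prime_pow hp).1 (hc ▸ hdvd)
      rw [hc, h] at hmod
      interval_cases k
      · have h3 : q ∣ p ^ 2 - 1 := (Nat.modEq_iff_dvd' (Nat.one_le_pow _ _ hp1)).1 hmod.symm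
        have h4 : p ^ 2 - 1 = (p + 1) * (p - 1) := by simpa using Nat.sq_sub_sq p 1
        rw [h4] at h3
        rcases hq.dvd_mul.1 h3 with h5 | h5
        · exact absurd h5 (h2 hc)
        · exact absurd h5 h1
      · have h3 : 1 * p ≡ p * p [MOD q] := by simpa [sq] using hmod.symm
        exact absurd (Nat.ModEq.cancel_right_of_coprime
          ((Nat.coprime_primes hq hp).2 hqp) h3) h1'
      · rw [h, hc]
  have hF : F = ⊤ := F.eq_top_of_card_eq key
  have hx : x ∈ F := hF ▸ mem_top x
  exact hx g

/-- A Sylow subgroup of order `p` or `p ^ 2` is centralized by its normalizer, under the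
divisibility conditions that exclude automorphisms of order `q` for the primes `q` involved. -/
theorem Sylow.normalizer_le_centralizer_of_card {G : Type*} [Group G] [Finite G] {p : ℕ}
    [hp : Fact p.Prime] (P : Sylow p G)
    (hcard : Nat.card P = p ∨ Nat.card P = p ^ 2)
    (h1 : ∀ q : ℕ, q.Prime → q ∣ Nat.card G → ¬ q ∣ p - 1)
    (h2 : ∀ q : ℕ, q.Prime → q ∣ Nat.card G → Nat.card P = p ^ 2 → ¬ q ∣ p + 1) :
    normalizer (P : Set G) ≤ centralizer (P : Set G) := by
  have hPcomm : ∀ a b : P, a * b = b * a := by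
    rcases hcard with hc | hc
    · have := isCyclic_of_prime_card hc
      exact (IsCyclic.isMulCommutative (α := P)).is_comm.comm
    · exact (IsPGroup.isMulCommutative_of_card_eq_prime_sq hc).is_comm.comm
  set N := normalizer (P : Set G) with hN
  let φ : N →* MulAut P := (P : Subgroup G).normalizerMonoidHom
  have hφ : ∀ (g : N) (x : P), ((φ g x : P) : G) = g * x * (g : G)⁻¹ := fun g x => rfl
  have hker : φ.ker = ⊤ := by
    rw [← index_eq_one]
    -- A prime q dividing the index of the kernel is impossible once a Sylow q-subgroup of the
    -- normalizer lies in that kernel.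
    by_contra hne
    obtain ⟨q, hq, hqd⟩ := Nat.exists_prime_and_dvd hne
    have := Fact.mk hq
    let Q : Sylow q N := default
    have hQ : (Q : Subgroup N) ≤ φ.ker := by
      intro g hg
      rw [MonoidHom.mem_ker]
      ext x
      rw [hφ, MulAut.one_apply]
      by_cases hqp : q = p
      -- For q = p, the join of Q with the normal p-subgroup P is a p-group, so maximality of P puts
      -- Q inside the abelian group P.
      · subst hqp
        have hgP : (g : G) ∈ P := by
          have hle : (Q : Subgroup N).map N.subtype ≤ P := by
            have hsup : IsPGroup q ((Q : Subgroup N).map N.subtype ⊔ P : Subgroup G) := by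
              refine IsPGroup.to_sup_of_normal_right' (Q.2.map _) P.2 ?_
              exact map_subtype_le _
            have := P.3 hsup le_sup_right
            rw [← this]
            exact le_sup_left
          exact hle (mem_map_of_mem N.subtype hg)
        have := congrArg (Subtype.val) (hPcomm ⟨g, hgP⟩ x)
        exact mul_inv_eq_of_eq_mul this
      · let : MulDistribMulAction Q P :=
          MulDistribMulAction.compHom P (φ.comp (Q : Subgroup N).subtype)
        have hqG : q ∣ Nat.card G :=
          (hqd.trans (index_dvd_card _)).trans (card_subgroup_dvd_card N)
        have := IsPGroup.smul_eq_self_of_card_prime_or_sq hp.out hq Q.2 hqp hcard (h1 q hq hqG)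
          (h2 q hq hqG) ⟨g, hg⟩ x
        exact congrArg Subtype.val this
    exact Q.not_dvd_index (hqd.trans (index_dvd_of_le hQ))
  intro g hg
  rw [mem_centralizer_iff]
  intro x hx
  have h3 : φ ⟨g, hg⟩ = 1 := by
    rw [← MonoidHom.mem_ker, hker]; exact mem_top _
  have h4 := hφ ⟨g, hg⟩ ⟨x, hx⟩
  rw [h3, MulAut.one_apply] at h4
  exact (eq_mul_inv_iff_mul_eq.1 h4)

/-- The arithmetic condition forcing all groups of order `n` to be abelian. -/
theorem mul_comm_of_card_cubeFree {n : ℕ} (hn : 0 < n) (hcube : IsCubeFree n)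
    (hpq : ¬ ∃ p q : ℕ, p.Prime ∧ q.Prime ∧ p ∣ n ∧ q ∣ n ∧
      (q ∣ p - 1 ∨ (q ∣ p + 1 ∧ p ^ 2 ∣ n)))
    {G : Type*} [Group G] (hG : Nat.card G = n) (a b : G) : a * b = b * a := by
  have : Finite G := Nat.finite_of_card_ne_zero (by omega)
  have hbot : commutator G = ⊥ := by
    rw [← card_eq_one]
    by_contra hne
    obtain ⟨p, hp, hpd⟩ := Nat.exists_prime_and_dvd hne
    have := Fact.mk hp
    have hpn : p ∣ n := hG ▸ hpd.trans (card_subgroup_dvd_card _)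
    let P : Sylow p G := default
    have hcP : Nat.card P = p ^ n.factorization p := hG ▸ P.card_eq_multiplicity
    have hpos : 1 ≤ n.factorization p := (hp.dvd_iff_one_le_factorization hn.ne').1 hpn
    have hle : n.factorization p ≤ 2 := by
      by_contra hlt
      have := hcube p ((pow_dvd_pow p (by omega)).trans (Nat.ordProj_dvd n p))
      exact hp.one_lt.ne' this
    have hcard : Nat.card P = p ∨ Nat.card P = p ^ 2 := by
      rw [hcP]
      interval_cases n.factorization p
      · left; simp
      · right; rfl
    have hNC : normalizer (P : Set G) ≤ centralizer (P : Set G) := by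
      refine P.normalizer_le_centralizer_of_card hcard ?_ ?_
      · intro q hq hqG h
        exact hpq ⟨p, q, hp, hq, hpn, hG ▸ hqG, Or.inl h⟩
      · intro q hq hqG hP h
        exact hpq ⟨p, q, hp, hq, hpn, hG ▸ hqG, Or.inr ⟨h, hP ▸ hG ▸ card_subgroup_dvd_card _⟩⟩
    have : IsMulCommutative P := ⟨⟨fun a b => Subtype.ext (hNC (le_normalizer b.2) a a.2)⟩⟩
    -- The transfer takes values in the abelian group P, so it kills all commutators.
    have hle : commutator G ≤ (MonoidHom.transferSylow P hNC).ker := by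
      rw [commutator_def, commutator_le]
      intro x _ y _
      rw [MonoidHom.mem_ker, map_commutatorElement, commutatorElement_eq_one_iff_mul_comm]
      exact mul_comm' _ _
    exact MonoidHom.not_dvd_card_ker_transferSylow P hNC (hpd.trans (card_dvd_of_le hle))
  rw [← commutatorElement_eq_one_iff_mul_comm, ← mem_bot, ← hbot]
  exact commutator_mem_commutator (mem_top a) (mem_top b)

/-! ### Unitriangular matrices: finite abelian groups as iterated derived groups. -/

/-- Matrices supported on or above the `m`-th superdiagonal. -/
def superdiagonal (N : ℕ) (R : Type*) [CommRing R] (m : ℕ) :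
    AddSubgroup (Matrix (Fin N) (Fin N) R) where
  carrier := {X | ∀ i j : Fin N, (j : ℕ) < i + m → X i j = 0}
  zero_mem' := fun _ _ _ => rfl
  add_mem' := fun hX hY i j h => by simp [hX i j h, hY i j h]
  neg_mem' := fun hX i j h => by simp [hX i j h]

section Superdiagonal

variable {N : ℕ} {R : Type*} [CommRing R]

theorem mem_superdiagonal {m : ℕ} {X : Matrix (Fin N) (Fin N) R} :
    X ∈ superdiagonal N R m ↔ ∀ i j : Fin N, (j : ℕ) < i + m → X i j = 0 := Iff.rfl

theorem mul_mem_superdiagonal {m l : ℕ} {X Y : Matrix (Fin N) (Fin N) R}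
    (hX : X ∈ superdiagonal N R m) (hY : Y ∈ superdiagonal N R l) :
    X * Y ∈ superdiagonal N R (m + l) := by
  intro i j h
  rw [Matrix.mul_apply]
  refine Finset.sum_eq_zero fun k _ => ?_
  by_cases hk : (k : ℕ) < i + m
  · rw [hX i k hk, zero_mul]
  · rw [hY k j (by omega), mul_zero]

theorem superdiagonal_anti {m l : ℕ} (h : m ≤ l) : superdiagonal N R l ≤ superdiagonal N R m :=
  fun _ hX i j hij => hX i j (by omega)

theorem one_mem_superdiagonal : (1 : Matrix (Fin N) (Fin N) R) ∈ superdiagonal N R 0 := by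
  intro i j h
  exact Matrix.one_apply_ne (by rintro rfl; omega)

theorem single_mem_superdiagonal {m : ℕ} {i j : Fin N} (h : (i : ℕ) + m ≤ j) (r : R) :
    Matrix.single i j r ∈ superdiagonal N R m := by
  intro a b hab
  refine Matrix.single_apply_of_ne _ _ _ _ _ ?_
  rintro ⟨rfl, rfl⟩
  omega

/-- Invertible matrices that differ from `1`, together with their inverse, only on or above the
`m`-th superdiagonal. -/
def unitriangular (N : ℕ) (R : Type*) [CommRing R] (m : ℕ) :
    Subgroup (Matrix (Fin N) (Fin N) R)ˣ where
  carrier := {x | (x : Matrix (Fin N) (Fin N) R) - 1 ∈ superdiagonal N R m ∧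
    ((x⁻¹ : (Matrix (Fin N) (Fin N) R)ˣ) : Matrix (Fin N) (Fin N) R) - 1 ∈ superdiagonal N R m}
  one_mem' := by simp
  inv_mem' := fun ⟨h1, h2⟩ => ⟨h2, by simpa using h1⟩
  mul_mem' := by
    have key : ∀ X Y : Matrix (Fin N) (Fin N) R, X - 1 ∈ superdiagonal N R m →
        Y - 1 ∈ superdiagonal N R m → X * Y - 1 ∈ superdiagonal N R m := by
      intro X Y hX hY
      have : X * Y - 1 = (X - 1) * (Y - 1) + (X - 1) + (Y - 1) := by noncomm_ring
      rw [this]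
      exact add_mem (add_mem (superdiagonal_anti (by omega) (mul_mem_superdiagonal hX hY)) hX) hY
    rintro x y ⟨hx, hx'⟩ ⟨hy, hy'⟩
    refine ⟨key _ _ hx hy, ?_⟩
    rw [mul_inv_rev]
    exact key _ _ hy' hx'

theorem mem_superdiagonal_zero_of_sub_one {m : ℕ} {X : Matrix (Fin N) (Fin N) R}
    (h : X - 1 ∈ superdiagonal N R m) : X ∈ superdiagonal N R 0 := by
  have := add_mem (superdiagonal_anti (Nat.zero_le m) h) one_mem_superdiagonal
  rwa [sub_add_cancel] at this

/-- With X = x - 1 and Y = y - 1 one has ⁅x, y⁆ - 1 = (XY - YX)x⁻¹y⁻¹, and products of two matrices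
of depth m have depth 2m. The inverse of the commutator is the commutator with x and y exchanged. -/
theorem commutatorElement_mem_unitriangular {m : ℕ} {x y : (Matrix (Fin N) (Fin N) R)ˣ}
    (hx : x ∈ unitriangular N R m) (hy : y ∈ unitriangular N R m) :
    ⁅x, y⁆ ∈ unitriangular N R (m + m) := by
  have key : ∀ {x y : (Matrix (Fin N) (Fin N) R)ˣ}, x ∈ unitriangular N R m →
      y ∈ unitriangular N R m →
      ((⁅x, y⁆ : (Matrix (Fin N) (Fin N) R)ˣ) : Matrix (Fin N) (Fin N) R) - 1 ∈
        superdiagonal N R (m + m) := by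
    rintro x y ⟨hx, hx'⟩ ⟨hy, hy'⟩
    have h1 : ((⁅x, y⁆ : (Matrix (Fin N) (Fin N) R)ˣ) : Matrix (Fin N) (Fin N) R) - 1 =
        (((x : Matrix (Fin N) (Fin N) R) - 1) * ((y : Matrix (Fin N) (Fin N) R) - 1) -
          ((y : Matrix (Fin N) (Fin N) R) - 1) * ((x : Matrix (Fin N) (Fin N) R) - 1)) *
        (((x⁻¹ : (Matrix (Fin N) (Fin N) R)ˣ) : Matrix (Fin N) (Fin N) R) *
          ((y⁻¹ : (Matrix (Fin N) (Fin N) R)ˣ) : Matrix (Fin N) (Fin N) R)) := by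
      have h2 : (((x : Matrix (Fin N) (Fin N) R) - 1) * ((y : Matrix (Fin N) (Fin N) R) - 1) -
          ((y : Matrix (Fin N) (Fin N) R) - 1) * ((x : Matrix (Fin N) (Fin N) R) - 1)) =
          (x : Matrix (Fin N) (Fin N) R) * y - y * x := by noncomm_ring
      have h3 : (y : Matrix (Fin N) (Fin N) R) * x *
          (((x⁻¹ : (Matrix (Fin N) (Fin N) R)ˣ) : Matrix (Fin N) (Fin N) R) *
          ((y⁻¹ : (Matrix (Fin N) (Fin N) R)ˣ) : Matrix (Fin N) (Fin N) R)) = 1 := by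
        rw [mul_assoc, Units.mul_inv_cancel_left, Units.mul_inv]
      rw [h2, sub_mul, h3, commutatorElement_def]
      simp [mul_assoc]
    rw [h1]
    have h0 := mul_mem_superdiagonal (mem_superdiagonal_zero_of_sub_one hx')
      (mem_superdiagonal_zero_of_sub_one hy')
    have := mul_mem_superdiagonal
      (sub_mem (mul_mem_superdiagonal hx hy) (mul_mem_superdiagonal hy hx)) h0
    simpa using this
  refine ⟨key hx hy, ?_⟩
  rw [commutatorElement_inv]
  exact key hy hx

/-- The elementary matrix `1 + r e i j`, for `i < j`, as an element of the unitriangular group. -/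
def unitriangularTransvection (i j : Fin N) (hij : i < j) (r : R) : unitriangular N R 1 :=
  ⟨⟨Matrix.transvection i j r, Matrix.transvection i j (-r),
    by rw [Matrix.transvection_mul_transvection_same _ _ hij.ne]; simp,
    by rw [Matrix.transvection_mul_transvection_same _ _ hij.ne]; simp⟩,
    by
      have h : (i : ℕ) + 1 ≤ j := hij
      constructor
      · simpa [Matrix.transvection] using single_mem_superdiagonal h r
      · simpa [Matrix.transvection] using single_mem_superdiagonal h (-r)⟩

theorem coe_unitriangularTransvection (i j : Fin N) (hij : i < j) (r : R) :
    ((unitriangularTransvection i j hij r : (Matrix (Fin N) (Fin N) R)ˣ) :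
      Matrix (Fin N) (Fin N) R) = Matrix.transvection i j r := rfl

theorem unitriangularTransvection_commutator {i j k : Fin N} (hij : i < j) (hjk : j < k) (r s : R) :
    ⁅unitriangularTransvection i j hij r, unitriangularTransvection j k hjk s⁆ =
      unitriangularTransvection i k (hij.trans hjk) (r * s) := by
  rw [commutatorElement_def, mul_inv_eq_iff_eq_mul, mul_inv_eq_iff_eq_mul]
  apply Subtype.ext
  apply Units.ext
  simp only [Subgroup.coe_mul, Units.val_mul, coe_unitriangularTransvection, Matrix.transvection]
  have h1 : i ≠ j := hij.ne
  have h2 : j ≠ k := hjk.ne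
  have h3 : i ≠ k := (hij.trans hjk).ne
  simp [mul_add, add_mul, Matrix.single_mul_single_of_ne, h2.symm, h3.symm]
  abel

/-- Lower bound for the derived series: cut the interval from i to j at i + 2 ^ k. Both halves have
length at least 2 ^ k, and the transvection is the commutator of those of the halves. -/
theorem unitriangularTransvection_mem_derivedSeries (k : ℕ) (i j : Fin N) (hij : i < j)
    (h : (i : ℕ) + 2 ^ k ≤ j) (r : R) :
    unitriangularTransvection i j hij r ∈ derivedSeries (unitriangular N R 1) k := by
  induction k generalizing i j r with
  | zero => exact Subgroup.mem_top _
  | succ k ih =>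
    have hpos : 0 < 2 ^ k := by positivity
    rw [pow_succ] at h
    let l : Fin N := ⟨i + 2 ^ k, by have := j.2; omega⟩
    have hil : i < l := Fin.lt_def.2 (by simp [l])
    have hlj : l < j := Fin.lt_def.2 (by simp only [l]; omega)
    have := unitriangularTransvection_commutator hil hlj r 1
    rw [mul_one] at this
    rw [← this, derivedSeries_succ]
    exact Subgroup.commutator_mem_commutator (ih i l hil (by simp [l]) r)
      (ih l j hlj (by simp only [l]; omega) 1)

theorem derivedSeries_unitriangular_le (k : ℕ) (x : unitriangular N R 1)
    (hx : x ∈ derivedSeries (unitriangular N R 1) k) :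
    (x : (Matrix (Fin N) (Fin N) R)ˣ) ∈ unitriangular N R (2 ^ k) := by
  induction k generalizing x with
  | zero => exact x.2
  | succ k ih =>
    have : derivedSeries (unitriangular N R 1) (k + 1) ≤
        (unitriangular N R (2 ^ (k + 1))).comap (unitriangular N R 1).subtype := by
      rw [derivedSeries_succ, Subgroup.commutator_le]
      intro a ha b hb
      rw [Subgroup.mem_comap, map_commutatorElement, pow_succ, mul_two]
      exact commutatorElement_mem_unitriangular (ih a ha) (ih b hb)
    exact this hx

end Superdiagonal

/-- The additive group of a commutative ring is the `k`-th derived group of the group of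
unitriangular matrices of size `2 ^ k + 1`. -/
theorem nonempty_derivedSeries_unitriangular (R : Type*) [CommRing R] (k : ℕ) :
    Nonempty (derivedSeries (unitriangular (2 ^ k + 1) R 1) k ≃* Multiplicative R) := by
  have h0 : (0 : Fin (2 ^ k + 1)) < Fin.last (2 ^ k) := Fin.lt_def.2 (by simp)
  let f : Multiplicative R →* derivedSeries (unitriangular (2 ^ k + 1) R 1) k :=
    { toFun := fun r => ⟨unitriangularTransvection 0 (Fin.last _) h0 r.toAdd,
        unitriangularTransvection_mem_derivedSeries k _ _ _ (by simp) _⟩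
      map_one' := by
        apply Subtype.ext; apply Subtype.ext; apply Units.ext
        simp [coe_unitriangularTransvection]
      map_mul' := fun r s => by
        apply Subtype.ext; apply Subtype.ext; apply Units.ext
        simp [coe_unitriangularTransvection, Matrix.transvection_mul_transvection_same _ _ h0.ne] }
  refine ⟨(MulEquiv.ofBijective f ⟨?_, ?_⟩).symm⟩
  · intro r s hrs
    have := congrArg (fun x : derivedSeries (unitriangular (2 ^ k + 1) R 1) k =>
      (((x : unitriangular (2 ^ k + 1) R 1) : (Matrix (Fin (2 ^ k + 1)) (Fin (2 ^ k + 1)) R)ˣ) : Matrix (Fin (2 ^ k + 1)) (Fin (2 ^ k + 1)) R)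
        0 (Fin.last (2 ^ k))) hrs
    simpa [f, coe_unitriangularTransvection, Matrix.transvection, Matrix.one_apply_ne h0.ne]
      using this
  · rintro ⟨x, hx⟩
    have hx' := (derivedSeries_unitriangular_le k x hx).1
    refine ⟨Multiplicative.ofAdd
      ((((x : (Matrix (Fin (2 ^ k + 1)) (Fin (2 ^ k + 1)) R)ˣ) : Matrix (Fin (2 ^ k + 1)) (Fin (2 ^ k + 1)) R)) 0 (Fin.last (2 ^ k))), ?_⟩
    apply Subtype.ext; apply Subtype.ext; apply Units.ext
    ext i j
    simp only [f, MonoidHom.coe_mk, OneHom.coe_mk, coe_unitriangularTransvection, toAdd_ofAdd,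
      Matrix.transvection, Matrix.add_apply]
    -- Indices run from 0 to 2 ^ k, so only the corner entry escapes the vanishing condition.
    by_cases hij : (j : ℕ) < i + 2 ^ k
    · have h1 := hx' i j hij
      rw [Matrix.sub_apply, sub_eq_zero] at h1
      rw [h1, Matrix.single_apply_of_ne, add_zero]
      rintro ⟨rfl, rfl⟩
      simp at hij
    · have hi : i = 0 := Fin.ext (by have := j.2; change (i : ℕ) = 0; omega)
      have hj : j = Fin.last _ := Fin.ext (by have := j.2; change (j : ℕ) = 2 ^ k; omega)
      subst hi hj
      simp [Matrix.one_apply_ne h0.ne]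

/-- A finite abelian group can be integrated any number of times. -/
theorem canBeIntegrated_of_comm (G : Type u) [Group G] [Finite G] (hG : ∀ a b : G, a * b = b * a)
    (k : ℕ) : CanBeIntegrated G k := by
  let : CommGroup G := { (inferInstance : Group G) with mul_comm := hG }
  obtain ⟨ι, _, p, _, e, ⟨f⟩⟩ := AddCommGroup.equiv_directSum_zmod_of_finite (Additive G)
  let g : Multiplicative (∀ i, ZMod (p i ^ e i)) ≃* G :=
    AddEquiv.toMultiplicativeLeft (f.trans (DirectSum.addEquivProd _)).symm
  -- The product of the cyclic factors is a commutative ring; `ULift` moves it to the universe of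
  -- `G`.
  obtain ⟨h⟩ := nonempty_derivedSeries_unitriangular (ULift.{u} (∀ i, ZMod (p i ^ e i))) k
  refine ⟨_, inferInstance, ⟨h.trans (MulEquiv.trans ?_ g)⟩⟩
  exact AddEquiv.toMultiplicative AddEquiv.ulift

/-! ### Constraints on the second derived group of an automorphism group. -/

section Automorphisms

/-- The conjugation of a `k`-th derived group by its own elements lies in the `k`-th derived group
of its automorphism group. -/
theorem conj_mem_derivedSeries_mulAut {H G : Type*} [Group H] [Group G] {k : ℕ}
    (e : derivedSeries H k ≃* G) (g : G) : MulAut.conj g ∈ derivedSeries (MulAut G) k := by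
  let f : H →* MulAut G := (MulAut.congr e).toMonoidHom.comp MulAut.conjNormal
  have h : f (e.symm g : H) = MulAut.conj g := by
    ext x
    simp [f, MulAut.conjNormal_val]
  rw [← h]
  exact map_derivedSeries_le_derivedSeries f k (mem_map_of_mem f (e.symm g).2)

/-- Here (ba)⁻¹ab = ⁅a⁻¹, b⁻¹⁆. When K is a stabilizer, the condition says that ab and ba agree on
the point. -/
theorem Subgroup.commutator_self_le_of_inv_mul_mem {M : Type*} [Group M] {S K : Subgroup M}
    (h : ∀ a ∈ S, ∀ b ∈ S, (b * a)⁻¹ * (a * b) ∈ K) : ⁅S, S⁆ ≤ K := by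
  rw [commutator_le]
  intro a ha b hb
  have := h a⁻¹ (inv_mem ha) b⁻¹ (inv_mem hb)
  rwa [← mul_inv_rev, inv_inv, ← mul_assoc] at this

/-- Let a group act on `X` by automorphisms. If all of them map `x` to powers of `x`, then
commutators fix `x`. -/
theorem apply_eq_self_of_mem_commutator {M X : Type*} [Group M] [Group X] (f : M →* MulAut X)
    {x : X} (hx : ∀ m, f m x ∈ zpowers x) {m : M} (hm : m ∈ commutator M) : f m x = x := by
  have hle : commutator M ≤ (MulAction.stabilizer (MulAut X) x).comap f := by
    rw [commutator_def]
    refine commutator_self_le_of_inv_mul_mem fun a _ b _ => ?_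
    obtain ⟨i, hi⟩ := hx a
    obtain ⟨j, hj⟩ := hx b
    dsimp only at hi hj
    have h : f a (f b x) = f b (f a x) := by
      rw [← hj, map_zpow, ← hi, map_zpow, ← hj, ← zpow_mul, ← zpow_mul, mul_comm]
    rw [mem_comap, MulAction.mem_stabilizer_iff, MulAut.smul_def, map_mul, map_inv, map_mul,
      map_mul, MulAut.mul_apply, MulAut.mul_apply, h]
    exact MulAut.inv_apply_self X (f b * f a) x
  exact hle hm

/-- If the centralizer of `γ` is commutative and the image of `r` normalizes the cyclic group
generated by `γ`, then `r` kills the second derived group. -/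
theorem map_eq_one_of_mem_derivedSeries_two {M B : Type*} [Group M] [Group B] (r : M →* B)
    {γ : B} (hr : ∀ m, r m * γ * (r m)⁻¹ ∈ zpowers γ)
    (hγ : ∀ a b : B, Commute a γ → Commute b γ → a * b = b * a)
    {m : M} (hm : m ∈ derivedSeries M 2) : r m = 1 := by
  -- Conjugation acts on γ by power maps, which commute; so M' maps into the centralizer of γ, and
  -- commutativity of that centralizer kills M''.
  have h1 : ∀ m ∈ commutator M, Commute (r m) γ := fun m hm =>
    mul_inv_eq_iff_eq_mul.1
      (apply_eq_self_of_mem_commutator (MulAut.conj.comp r) (x := γ) hr hm)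
  have hle : derivedSeries M 2 ≤ r.ker := by
    rw [derivedSeries_succ, derivedSeries_one, commutator_le]
    intro a ha b hb
    rw [MonoidHom.mem_ker, map_commutatorElement, commutatorElement_eq_one_iff_mul_comm]
    exact hγ _ _ (h1 a ha) (h1 b hb)
  exact hle hm

/-- If all automorphisms act triangularly on the commuting pair `z`, `b`, then the second derived
group of the automorphism group fixes `b`. -/
theorem apply_eq_self_of_triangular {G : Type*} [Group G] {z b : G} (hzb : Commute z b)
    (hz : ∀ φ : MulAut G, φ z ∈ zpowers z)
    (hb : ∀ φ : MulAut G, ∃ i j : ℤ, φ b = z ^ i * b ^ j)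
    {ψ : MulAut G} (hψ : ψ ∈ derivedSeries (MulAut G) 2) : ψ b = b := by
  have hcomp : ∀ φ ψ : MulAut G, ∀ i j k l : ℤ, φ b = z ^ i * b ^ j → ψ b = z ^ k * b ^ l →
      ∃ s : ℤ, φ (ψ b) = z ^ s * b ^ (j * l) := by
    intro φ ψ i j k l hφ hψ
    obtain ⟨t, ht⟩ := hz φ
    refine ⟨t * k + i * l, ?_⟩
    rw [hψ, map_mul, map_zpow, map_zpow, hφ, ← ht,
      ((hzb.zpow_left i).zpow_right j).mul_zpow, ← zpow_mul, ← zpow_mul, ← zpow_mul, zpow_add,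
      mul_assoc]
  -- In the pair (z, b) automorphisms act like triangular matrices, so commutators act like
  -- unitriangular ones. These only multiply b by powers of the fixed element z, hence agree on b in
  -- either order.
  have hK : ∀ ψ ∈ commutator (MulAut G), ψ z = z ∧ ∃ i : ℤ, ψ b = z ^ i * b := by
    let K : Subgroup (MulAut G) :=
      { carrier := {ψ | ψ z = z ∧ ∃ i : ℤ, ψ b = z ^ i * b}
        one_mem' := ⟨rfl, 0, by simp⟩
        mul_mem' := by
          rintro φ ψ ⟨h1, i, hi⟩ ⟨h2, j, hj⟩
          refine ⟨by rw [MulAut.mul_apply, h2, h1], j + i, ?_⟩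
          rw [MulAut.mul_apply, hj, map_mul, map_zpow, h1, hi, zpow_add, mul_assoc]
        inv_mem' := by
          rintro φ ⟨h1, i, hi⟩
          have h1' : φ⁻¹ z = z := by rw [MulAut.inv_apply, MulEquiv.symm_apply_eq, h1]
          refine ⟨h1', -i, ?_⟩
          rw [MulAut.inv_apply, MulEquiv.symm_apply_eq, map_mul, map_zpow, h1, hi, ← mul_assoc,
            ← zpow_add, neg_add_cancel, zpow_zero, one_mul] }
    have hle : commutator (MulAut G) ≤ K := by
      rw [commutator_def]
      refine commutator_self_le_of_inv_mul_mem fun φ _ ψ _ => ⟨?_, ?_⟩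
      · refine apply_eq_self_of_mem_commutator (MonoidHom.id (MulAut G)) hz ?_
        have := commutator_mem_commutator (mem_top φ⁻¹) (mem_top ψ⁻¹)
        rwa [commutatorElement_def, ← mul_inv_rev, inv_inv, inv_inv, mul_assoc] at this
      · obtain ⟨i, j, h1⟩ := hb φ
        obtain ⟨k, l, h2⟩ := hb ψ
        obtain ⟨s, hs⟩ := hcomp φ ψ i j k l h1 h2
        obtain ⟨t, ht⟩ := hcomp ψ φ k l i j h2 h1
        obtain ⟨d, hd⟩ := hz (ψ * φ)⁻¹
        have h3 : φ (ψ b) = z ^ (s - t) * ψ (φ b) := by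
          rw [hs, ht, ← mul_assoc, ← zpow_add, sub_add_cancel, mul_comm j l]
        refine ⟨d * (s - t), ?_⟩
        rw [MulAut.mul_apply, MulAut.mul_apply, h3, map_mul, map_zpow, ← hd,
          ← MulAut.mul_apply G ψ, MulAut.inv_apply_self, zpow_mul]
    exact fun ψ hψ => hle hψ
  have hle : derivedSeries (MulAut G) 2 ≤ MulAction.stabilizer (MulAut G) b := by
    rw [derivedSeries_succ, derivedSeries_one]
    refine commutator_self_le_of_inv_mul_mem fun φ hφ ψ hψ => ?_
    obtain ⟨h1, i, hi⟩ := hK φ hφ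
    obtain ⟨h2, j, hj⟩ := hK ψ hψ
    have h3 : φ (ψ b) = (ψ * φ) b := by
      rw [MulAut.mul_apply, hi, hj, map_mul, map_mul, map_zpow, map_zpow, h1, h2, hi, hj,
        ← mul_assoc, ← mul_assoc, ← zpow_add, ← zpow_add, add_comm]
    rw [MulAction.mem_stabilizer_iff, MulAut.smul_def, MulAut.mul_apply, MulAut.mul_apply, h3,
      MulAut.inv_apply_self]
  exact hle hψ

/-- Automorphisms restrict to a characteristic subgroup, here given as the range of an injective
homomorphism. -/
theorem exists_mulAut_restrict {A G : Type*} [Group A] [Group G] (ι : A →* G)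
    (hι : Function.Injective ι) [hc : ι.range.Characteristic] :
    ∃ r : MulAut G →* MulAut A, ∀ φ v, ι (r φ v) = φ (ι v) := by
  have hmem : ∀ (φ : MulAut G) (x : G), x ∈ ι.range → φ x ∈ ι.range := fun φ x hx =>
    characteristic_iff_le_comap.1 hc φ hx
  let e : A ≃* ι.range := MonoidHom.ofInjective hι
  let r' : MulAut G →* MulAut ι.range :=
    { toFun := fun φ =>
        { toFun := fun x => ⟨φ x, hmem φ x x.2⟩
          invFun := fun x => ⟨φ⁻¹ x, hmem φ⁻¹ x x.2⟩
          left_inv := fun x => Subtype.ext (MulAut.inv_apply_self G φ x)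
          right_inv := fun x => Subtype.ext (MulAut.apply_inv_self G φ x)
          map_mul' := fun x y => Subtype.ext (map_mul φ (x : G) y) }
      map_one' := rfl
      map_mul' := fun _ _ => rfl }
  refine ⟨(MulAut.congr e.symm).toMonoidHom.comp r', fun φ v => ?_⟩
  have h : ∀ y : ι.range, ι (e.symm y) = y := fun y =>
    congrArg Subtype.val (e.apply_symm_apply y)
  exact h _

end Automorphisms

/-! ### The case 8 ∣ n: dihedral groups. -/

section Dihedral

/-- Reflections have order 2 < m, so every automorphism sends the rotation `r 1` to a power of
itself. Already the first derived group of the automorphism group fixes `r 1`, whereas a reflection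
inverts it. -/
theorem DihedralGroup.exists_conj_notMem_derivedSeries {m : ℕ} (hm : 3 ≤ m) :
    ∃ g : DihedralGroup m, MulAut.conj g ∉ derivedSeries (MulAut (DihedralGroup m)) 2 := by
  have hr : ∀ φ : MulAut (DihedralGroup m), φ (r 1) ∈ zpowers (r 1) := by
    intro φ
    have ho : orderOf (φ (r 1)) = m := by
      rw [φ.orderOf_eq, orderOf_r_one]
    cases h : φ (r 1) with
    | r i =>
      exact ⟨(i.cast : ℤ), by simp⟩
    | sr i =>
      rw [h, orderOf_sr] at ho
      omega
  refine ⟨sr 0, fun h => ?_⟩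
  have h1 := apply_eq_self_of_mem_commutator (MonoidHom.id _) hr
    (derivedSeries_antitone _ one_le_two h)
  have h2 : (r (-1) : DihedralGroup m) = r 1 := by simpa using h1
  have h3 : (-1 : ZMod m) = 1 := by simpa using h2
  have h4 : ((2 : ℕ) : ZMod m) = 0 := by
    rw [neg_eq_iff_add_eq_zero] at h3
    rw [← h3]; norm_num
  rw [ZMod.natCast_eq_zero_iff] at h4
  have := Nat.le_of_dvd two_pos h4
  omega

end Dihedral

/-! ### Groups of affine maps over a commutative ring. -/

section Affine

variable {R : Type*} [CommRing R]

/-- Multiplication by units, as automorphisms of the additive group of a ring. -/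
def unitsMulAut (R : Type*) [CommRing R] : Rˣ →* MulAut (Multiplicative R) where
  toFun u :=
    { toFun := fun v => Multiplicative.ofAdd (u * v.toAdd)
      invFun := fun v => Multiplicative.ofAdd (↑u⁻¹ * v.toAdd)
      left_inv := fun v => by simp
      right_inv := fun v => by simp
      map_mul' := fun v w => by simp [mul_add] }
  map_one' := by ext; simp
  map_mul' u v := by ext; simp [mul_assoc]

@[simp]
theorem unitsMulAut_apply (u : Rˣ) (v : Multiplicative R) :
    unitsMulAut R u v = Multiplicative.ofAdd (u * v.toAdd) := rfl

/-- The group of affine maps `x ↦ s * x + v` of a ring, with `s` a power of a fixed unit `u`. -/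
abbrev AffineGroup (u : Rˣ) : Type _ :=
  Multiplicative R ⋊[(unitsMulAut R).comp (zpowers u).subtype] zpowers u

theorem AffineGroup.card (u : Rˣ) : Nat.card (AffineGroup u) = Nat.card R * orderOf u := by
  rw [SemidirectProduct.card, Nat.card_zpowers]
  rfl

end Affine

/-! ### Affine groups over fields of order p and p². -/

section Field

variable {F : Type*} [Field F]

/-- In a field of order `p` or `p ^ 2`, generated by `ζ` over its prime field, the additive
automorphisms that commute with multiplication by `ζ` commute with each other. -/
theorem mul_comm_of_commute_unitsMulAut {p : ℕ} (hp : p.Prime) {ζ : Fˣ}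
    (hF : Nat.card F = p ∨ (Nat.card F = p ^ 2 ∧ ¬ orderOf ζ ∣ p - 1))
    (a b : MulAut (Multiplicative F)) (ha : Commute a (unitsMulAut F ζ))
    (hb : Commute b (unitsMulAut F ζ)) : a * b = b * a := by
  have hfin : Finite F := Nat.finite_of_card_ne_zero (by
    rcases hF with h | ⟨h, -⟩ <;> rw [h]
    · exact hp.ne_zero
    · exact pow_ne_zero 2 hp.ne_zero)
  have key : ∀ f : MulAut (Multiplicative F), Commute f (unitsMulAut F ζ) →
      ∀ v : F, (f (Multiplicative.ofAdd v)).toAdd = v * (f (Multiplicative.ofAdd 1)).toAdd := by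
    intro f hf
    let g : F →+ F := MonoidHom.toAdditive f.toMonoidHom
    change ∀ v : F, g v = v * g 1
    have hg : ∀ v, g (ζ * v) = ζ * g v := fun v =>
      congrArg Multiplicative.toAdd (DFunLike.congr_fun hf.eq (Multiplicative.ofAdd v))
    -- The scalars over which g is linear form a subfield containing ζ. It is all of F: in the p²
    -- case a subfield of order p would give ζ ^ (p - 1) = 1. Hence g is multiplication by g 1.
    let S : Subfield F :=
      { carrier := {x | ∀ v, g (x * v) = x * g v}
        mul_mem' := fun {x y} hx hy v => by rw [mul_assoc, hx, hy, mul_assoc]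
        one_mem' := fun v => by simp
        add_mem' := fun {x y} hx hy v => by rw [add_mul, map_add, hx, hy, add_mul]
        zero_mem' := fun v => by simp
        neg_mem' := fun {x} hx v => by rw [neg_mul, map_neg, hx, neg_mul]
        inv_mem' := fun x hx v => by
          by_cases h0 : x = 0
          · simp [h0]
          · rw [eq_inv_mul_iff_mul_eq₀ h0, ← hx, mul_inv_cancel_left₀ h0] }
    have hdvd : Nat.card S ∣ Nat.card F := S.toAddSubgroup.card_addSubgroup_dvd_card
    have hne : Nat.card S ≠ 1 := (Finite.one_lt_card (α := S)).ne'
    have hcard : Nat.card S = Nat.card F := by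
      rcases hF with h | ⟨h, hζ⟩
      · rw [h] at hdvd ⊢
        exact ((Nat.dvd_prime hp).1 hdvd).resolve_left hne
      · rw [h] at hdvd ⊢
        obtain ⟨k, hk, hk'⟩ := (Nat.dvd_prime_pow hp).1 hdvd
        interval_cases k
        · exact absurd (by simpa using hk') hne
        · have := Fintype.ofFinite S
          have hζ0 : (⟨ζ, hg⟩ : S) ≠ 0 := fun h => ζ.ne_zero (congrArg Subtype.val h)
          have h1 := FiniteField.pow_card_sub_one_eq_one _ hζ0
          rw [← Nat.card_eq_fintype_card, hk', pow_one] at h1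
          refine absurd (orderOf_dvd_of_pow_eq_one (Units.ext ?_)) hζ
          simpa using congrArg Subtype.val h1
        · exact hk'
    have htop : S.toAddSubgroup = ⊤ := AddSubgroup.eq_top_of_card_eq _ hcard
    intro v
    have hv : v ∈ S.toAddSubgroup := htop ▸ AddSubgroup.mem_top v
    have := hv 1
    rwa [mul_one] at this
  ext v
  have h1 := key a ha
  have h2 := key b hb
  change (a (Multiplicative.ofAdd (b (Multiplicative.ofAdd v.toAdd)).toAdd)).toAdd =
    (b (Multiplicative.ofAdd (a (Multiplicative.ofAdd v.toAdd)).toAdd)).toAdd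
  rw [h1 (Multiplicative.toAdd (b _)), h2 v.toAdd, h2 (Multiplicative.toAdd (a _)), h1 v.toAdd]
  ring

/-- The affine group of a field of order `p` or `p ^ 2`, generated by `ζ` over its prime field,
times an abelian group, has inner automorphisms outside the second derived group of the
automorphism group. -/
theorem AffineGroup.exists_conj_notMem_derivedSeries {p : ℕ} (hp : p.Prime) {ζ : Fˣ} (hζ : ζ ≠ 1)
    (hF : Nat.card F = p ∨ (Nat.card F = p ^ 2 ∧ ¬ orderOf ζ ∣ p - 1))
    (C : Type*) [CommGroup C] :
    ∃ g : AffineGroup ζ × C, MulAut.conj g ∉ derivedSeries (MulAut (AffineGroup ζ × C)) 2 := by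
  let ι : Multiplicative F →* AffineGroup ζ × C :=
    (MonoidHom.inl _ _).comp SemidirectProduct.inl
  have hι : Function.Injective ι := fun v w h =>
    SemidirectProduct.inl_injective (congrArg Prod.fst h)
  have hconj : ∀ (g : AffineGroup ζ × C) (v : Multiplicative F),
      g * ι v * g⁻¹ = ι (unitsMulAut F g.1.right v) := by
    intro g v
    rw [mul_inv_eq_iff_eq_mul]
    refine Prod.ext (SemidirectProduct.ext ?_ ?_) ?_
    · simp [ι, mul_comm]
    · simp [ι]
    · simp [ι]
  let g₀ : AffineGroup ζ × C := (SemidirectProduct.inr ⟨ζ, mem_zpowers ζ⟩, 1)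
  have hg₀ : (g₀.1.right : Fˣ) = ζ := rfl
  -- The translations are characteristic because they form the derived subgroup; invertibility of ζ
  -- - 1 makes each one a commutator.
  have hrange : ι.range = commutator (AffineGroup ζ × C) := by
    apply le_antisymm
    · rintro _ ⟨v, rfl⟩
      have hz : (ζ : F) - 1 ≠ 0 := fun h => hζ (Units.ext (sub_eq_zero.1 h))
      have h1 : ι v = ⁅g₀, ι (Multiplicative.ofAdd (v.toAdd / ((ζ : F) - 1)))⁆ := by
        rw [commutatorElement_def, hconj, ← map_inv, ← map_mul, hg₀]
        congr 1
        apply Multiplicative.toAdd.injective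
        simp
        field_simp
        ring
      rw [h1]
      exact commutator_mem_commutator (mem_top _) (mem_top _)
    · let π : AffineGroup ζ × C →* zpowers ζ × C :=
        SemidirectProduct.rightHom.prodMap (MonoidHom.id C)
      refine (Abelianization.commutator_subset_ker π).trans fun x hx => ?_
      have h1 : x.1.right = 1 := congrArg Prod.fst hx
      have h2 : x.2 = 1 := congrArg Prod.snd hx
      exact ⟨x.1.left, Prod.ext (SemidirectProduct.ext rfl h1.symm) h2.symm⟩
  have hchar : ι.range.Characteristic := by rw [hrange]; infer_instance
  obtain ⟨r, hr⟩ := exists_mulAut_restrict ι hι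
  refine ⟨g₀, fun h => ?_⟩
  have h1 : r (MulAut.conj g₀) = 1 := by
    refine map_eq_one_of_mem_derivedSeries_two r (γ := unitsMulAut F ζ) ?_
      (mul_comm_of_commute_unitsMulAut hp hF) h
    intro φ
    -- An automorphism conjugates multiplication by ζ into multiplication by the linear part of the
    -- image of `g₀`, which is again a power of ζ.
    have h2 : r φ * unitsMulAut F ζ * (r φ)⁻¹ = unitsMulAut F (φ g₀).1.right := by
      rw [mul_inv_eq_iff_eq_mul]
      ext1 v
      apply hι
      have h3 : ι (unitsMulAut F ζ v) = g₀ * ι v * g₀⁻¹ := (hconj g₀ v).symm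
      rw [MulAut.mul_apply, MulAut.mul_apply, ← hconj, hr, hr, h3, map_mul, map_mul, map_inv]
    rw [h2, ← MonoidHom.map_zpowers]
    exact mem_map_of_mem _ (φ g₀).1.right.2
  have h2 := hr (MulAut.conj g₀) (Multiplicative.ofAdd 1)
  rw [h1, MulAut.conj_apply, hconj, hg₀, MulAut.one_apply] at h2
  have h3 := congrArg Multiplicative.toAdd (hι h2)
  simp at h3
  exact hζ (Units.ext h3.symm)

/-- Take ζ of order q in the field of p ^ k elements. For k = 2, the condition that q does not
divide p - 1 keeps ζ out of the prime field. A cyclic factor pads the order to n. -/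
theorem exists_group_of_dvd_pow_sub_one {p q k n : ℕ} (hp : p.Prime) (hq : q.Prime) (hn : n ≠ 0)
    (hk : k = 1 ∨ (k = 2 ∧ ¬ q ∣ p - 1)) (hq1 : q ∣ p ^ k - 1) (hdvd : p ^ k * q ∣ n) :
    ∃ (G : Type) (_ : Group G), Nat.card G = n ∧
      ∃ g : G, MulAut.conj g ∉ derivedSeries (MulAut G) 2 := by
  have := Fact.mk hp
  have := Fact.mk hq
  have hk0 : k ≠ 0 := by omega
  obtain ⟨m, rfl⟩ := hdvd
  have hcard := GaloisField.card p k hk0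
  have hfin : Finite (GaloisField p k) :=
    Nat.finite_of_card_ne_zero (by rw [hcard]; exact pow_ne_zero _ hp.ne_zero)
  obtain ⟨ζ, hζ⟩ := exists_prime_orderOf_dvd_card' (G := (GaloisField p k)ˣ) q
    (by rwa [Nat.card_units, hcard])
  refine ⟨AffineGroup ζ × Multiplicative (ZMod m), inferInstance, ?_, ?_⟩
  · rw [Nat.card_prod, AffineGroup.card, hcard, hζ]
    congr 1
    exact Nat.card_zmod m
  · refine AffineGroup.exists_conj_notMem_derivedSeries hp ?_ ?_ _
    · rintro rfl
      rw [orderOf_one] at hζ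
      exact hq.one_lt.ne hζ
    · rw [hcard, hζ]
      rcases hk with rfl | ⟨rfl, h⟩
      · left; simp
      · right; exact ⟨rfl, h⟩

end Field

/-! ### The case p³ ∣ n with p odd. -/

section Modular

/-- Since d² = 0, (1 + d)^j = 1 + jd; summing over j < k gives the translation factor k + (k choose
2)d. -/
theorem AffineGroup.pow_eq {R : Type*} [CommRing R] {u : Rˣ} (x : AffineGroup u) {d : R}
    (hd : d * d = 0) (hx : ((x.right : Rˣ) : R) = 1 + d) (k : ℕ) :
    (((x ^ k).right : Rˣ) : R) = 1 + k * d ∧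
      (x ^ k).left.toAdd = (k + k.choose 2 * d) * x.left.toAdd := by
  induction k with
  | zero => simp
  | succ k ih =>
    obtain ⟨h1, h2⟩ := ih
    rw [pow_succ]
    constructor
    · rw [SemidirectProduct.mul_right, Subgroup.coe_mul, Units.val_mul, h1, hx]
      push_cast
      linear_combination (k : R) * hd
    · have h3 : (x ^ k * x).left.toAdd =
          (x ^ k).left.toAdd + (((x ^ k).right : Rˣ) : R) * x.left.toAdd := rfl
      rw [h3, h1, h2, Nat.choose_succ_succ' k 1]
      push_cast
      rw [Nat.choose_one_right]
      ring

/-- Let w = pm in ℤ/p²m, z the translation by w and b the multiplication by u = 1 + w. All solutions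
of x ^ p = 1 have the form z^i b^j, so automorphisms are triangular on (z, b) and the second derived
group fixes b. Conjugation by the translation by 1 moves b, as w ≠ 0. -/
theorem exists_group_of_odd_cube_dvd {p n : ℕ} (hp : p.Prime) (hp2 : p ≠ 2) (hn : n ≠ 0)
    (hdvd : p ^ 3 ∣ n) :
    ∃ (G : Type) (_ : Group G), Nat.card G = n ∧
      ∃ g : G, MulAut.conj g ∉ derivedSeries (MulAut G) 2 := by
  obtain ⟨m, rfl⟩ := hdvd
  have hm : m ≠ 0 := by rintro rfl; simp at hn
  have := Fact.mk hp
  have hN : p ^ 2 * m ≠ 0 := mul_ne_zero (pow_ne_zero _ hp.ne_zero) hm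
  have := NeZero.mk hN
  set N := p ^ 2 * m with hNdef
  let w : ZMod N := ((p * m : ℕ) : ZMod N)
  have hpw : (p : ZMod N) * w = 0 := by
    simp only [w]
    rw [← Nat.cast_mul, ZMod.natCast_eq_zero_iff, hNdef]
    exact ⟨1, by ring⟩
  have hww : w * w = 0 := by
    have : w = (p : ZMod N) * m := by simp [w]
    calc w * w = m * (p * w) := by rw [this]; ring
      _ = 0 := by rw [hpw, mul_zero]
  have hw : w ≠ 0 := by
    simp only [w]
    rw [Ne, ZMod.natCast_eq_zero_iff]
    intro h
    have h1 := Nat.le_of_dvd (Nat.pos_of_ne_zero (mul_ne_zero hp.ne_zero hm)) h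
    have h2 : p * m < N := by
      rw [hNdef, sq, mul_assoc]
      exact lt_mul_left (Nat.pos_of_ne_zero (mul_ne_zero hp.ne_zero hm)) hp.one_lt
    omega
  have htors : ∀ v : ZMod N, (p : ZMod N) * v = 0 → ∃ t : ℕ, v = t * w := by
    intro v hv
    rw [← ZMod.natCast_zmod_val v, ← Nat.cast_mul, ZMod.natCast_eq_zero_iff] at hv
    have hN' : p * (p * m) = N := by rw [hNdef]; ring
    have h1 : p * m ∣ v.val := Nat.dvd_of_mul_dvd_mul_left hp.pos (hN'.dvd.trans hv)
    obtain ⟨t, ht⟩ := h1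
    refine ⟨t, ?_⟩
    rw [← ZMod.natCast_zmod_val v, ht]
    push_cast
    simp only [w]
    push_cast
    ring
  let u : (ZMod N)ˣ := ⟨1 + w, 1 - w, by linear_combination -hww, by linear_combination -hww⟩
  have hu : ∀ k : ℕ, ((u ^ k : (ZMod N)ˣ) : ZMod N) = 1 + k * w := by
    intro k
    induction k with
    | zero => simp
    | succ k ih =>
      rw [pow_succ, Units.val_mul, ih]
      push_cast
      linear_combination (k : ZMod N) * hww
  have hup : u ^ p = 1 := Units.ext (by rw [hu, hpw, add_zero, Units.val_one])
  have horder : orderOf u = p := by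
    refine orderOf_eq_prime hup fun h => hw ?_
    simpa [u] using congrArg Units.val h
  have hzp : ∀ s : zpowers u, ∃ k : ℕ, (s : (ZMod N)ˣ) = u ^ k := fun s => by
    obtain ⟨k, hk⟩ := mem_powers_iff_mem_zpowers.2 s.2
    exact ⟨k, hk.symm⟩
  let ι : Multiplicative (ZMod N) →* AffineGroup u := SemidirectProduct.inl
  let z : AffineGroup u := ι (Multiplicative.ofAdd w)
  let b : AffineGroup u := SemidirectProduct.inr ⟨u, mem_zpowers u⟩
  have hzpow : ∀ t : ℕ, z ^ t = ι (Multiplicative.ofAdd ((t : ZMod N) * w)) := by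
    intro t
    rw [← map_pow, ← ofAdd_nsmul, nsmul_eq_mul]
  -- Oddness of p enters here: 2 does not divide (2 choose 2) = 1.
  have hchoose : ∃ c, p.choose 2 = p * c :=
    hp.dvd_choose_self two_ne_zero (lt_of_le_of_ne hp.two_le hp2.symm)
  have hpow : ∀ x : AffineGroup u, x ^ p = 1 → ∃ t : ℕ, x.left = Multiplicative.ofAdd (t * w) := by
    intro x hx
    obtain ⟨k, hk⟩ := hzp x.right
    have h1 := (AffineGroup.pow_eq x (d := k * w)
      (by linear_combination (k : ZMod N) * k * hww) (by rw [hk, hu]) p).2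
    obtain ⟨c, hc⟩ := hchoose
    have h0 : (x ^ p).left.toAdd = 0 := by rw [hx]; rfl
    rw [h0, hc] at h1
    push_cast at h1
    obtain ⟨t, ht⟩ := htors x.left.toAdd
      (by linear_combination -h1 - (c : ZMod N) * k * x.left.toAdd * hpw)
    exact ⟨t, congrArg Multiplicative.ofAdd ht⟩
  have hbp : b ^ p = 1 := by
    rw [← map_pow]
    have : (⟨u, mem_zpowers u⟩ : zpowers u) ^ p = 1 := Subtype.ext hup
    rw [this, map_one]
  have hzp1 : z ^ p = 1 := by rw [hzpow, hpw, ofAdd_zero, map_one]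
  have hzcomm : z = ⁅b, ι (Multiplicative.ofAdd 1)⁆ := by
    refine SemidirectProduct.ext ?_ ?_
    · apply Multiplicative.toAdd.injective
      simp [z, b, ι, commutatorElement_def, u]
    · simp [z, b, ι, commutatorElement_def]
  have hzb : Commute z b := by
    refine SemidirectProduct.ext ?_ ?_
    · apply Multiplicative.toAdd.injective
      simp [z, b, ι, u, add_mul, hww]
    · simp [z, b, ι]
  refine ⟨AffineGroup u, inferInstance, ?_, ι (Multiplicative.ofAdd 1), fun h => ?_⟩
  · rw [AffineGroup.card, Nat.card_zmod, horder, hNdef]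
    ring
  have h1 := apply_eq_self_of_triangular hzb ?_ ?_ h
  · have h2 := congrArg (fun x : AffineGroup u => x.left.toAdd) h1
    simp [b, ι, u, hw] at h2
  · intro φ
    obtain ⟨t, ht⟩ := hpow (φ z) (by rw [← map_pow, hzp1, map_one])
    -- Since z is a commutator, so is its image, and linear parts commute.
    have hr : (φ z).right = 1 := by
      have h2 : SemidirectProduct.rightHom (φ z) = 1 := by
        rw [hzcomm, map_commutatorElement, map_commutatorElement,
          commutatorElement_eq_one_iff_mul_comm]
        exact mul_comm _ _
      exact h2
    refine ⟨t, ?_⟩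
    dsimp only
    rw [zpow_natCast, hzpow]
    exact SemidirectProduct.ext ht.symm hr.symm
  · intro φ
    obtain ⟨t, ht⟩ := hpow (φ b) (by rw [← map_pow, hbp, map_one])
    obtain ⟨k, hk⟩ := hzp (φ b).right
    refine ⟨t, k, ?_⟩
    rw [zpow_natCast, zpow_natCast, hzpow, ← map_pow]
    refine SemidirectProduct.ext ?_ ?_
    · simpa [ι] using ht
    · simp only [ι, SemidirectProduct.mul_right, SemidirectProduct.right_inl,
        SemidirectProduct.right_inr, one_mul]
      exact Subtype.ext hk

end Modular

/-! ### Assembly of the counterexamples and of the equivalence. -/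

/-- If `n` violates the arithmetic condition, then some group of order `n` has inner automorphisms
outside the second derived group of its automorphism group. -/
theorem exists_group_conj_notMem_derivedSeries {n : ℕ} (hn : n ≠ 0)
    (h : ¬ (IsCubeFree n ∧
        ¬ ∃ p q : ℕ, p.Prime ∧ q.Prime ∧ p ∣ n ∧ q ∣ n ∧
          (q ∣ p - 1 ∨ (q ∣ p + 1 ∧ p ^ 2 ∣ n)))) :
    ∃ (G : Type) (_ : Group G), Nat.card G = n ∧
      ∃ g : G, MulAut.conj g ∉ derivedSeries (MulAut G) 2 := by
  rw [not_and_or, not_not] at h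
  rcases h with h | ⟨p, q, hp, hq, hpn, hqn, h⟩
  · simp only [IsCubeFree, not_forall] at h
    obtain ⟨d, hd, hd1⟩ := h
    obtain ⟨p, hp, hpd⟩ := Nat.exists_prime_and_dvd hd1
    have hp3 : p ^ 3 ∣ n := (pow_dvd_pow_of_dvd hpd 3).trans hd
    by_cases hp2 : p = 2
    · subst hp2
      obtain ⟨m, rfl⟩ := hp3
      refine ⟨DihedralGroup (4 * m), inferInstance, ?_,
        DihedralGroup.exists_conj_notMem_derivedSeries (by omega)⟩
      rw [DihedralGroup.nat_card]
      ring
    · exact exists_group_of_odd_cube_dvd hp hp2 hn hp3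
  -- The field of order p serves if q ∣ p - 1; otherwise the failure of this divisibility is what
  -- the field of order p² needs.
  · by_cases h1 : q ∣ p - 1
    · have hne : p ≠ q := by
        rintro rfl
        have := Nat.le_of_dvd (Nat.sub_pos_of_lt hp.one_lt) h1
        have := hp.pos
        omega
      refine exists_group_of_dvd_pow_sub_one (k := 1) hp hq hn (Or.inl rfl) (by simpa using h1) ?_
      rw [pow_one]
      exact ((Nat.coprime_primes hp hq).2 hne).mul_dvd_of_dvd_of_dvd hpn hqn
    · obtain ⟨h2, h3⟩ := h.resolve_left h1
      have hne : p ≠ q := by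
        rintro rfl
        exact hp.one_lt.ne' (Nat.dvd_one.1 ((Nat.dvd_add_right dvd_rfl).1 h2))
      refine exists_group_of_dvd_pow_sub_one (k := 2) hp hq hn (Or.inr ⟨rfl, h1⟩) ?_ ?_
      · have : p ^ 2 - 1 = (p + 1) * (p - 1) := by simpa using Nat.sq_sub_sq p 1
        rw [this]
        exact h2.mul_right _
      · exact (((Nat.coprime_primes hp hq).2 hne).pow_left 2).mul_dvd_of_dvd_of_dvd h3 hqn

end

theorem mainTheorem5 (n : ℕ) (hn : 0 < n) :
    List.TFAE [
      ∀ (G : Type u) [Group G], Nat.card G = n → ∀ a b : G, a * b = b * a,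
      ∀ (G : Type u) [Group G], Nat.card G = n → CanBeIntegrated G 2,
      ∀ (G : Type u) [Group G], Nat.card G = n → ∀ k : ℕ, CanBeIntegrated G k,
      IsCubeFree n ∧
        ¬ ∃ p q : ℕ, p.Prime ∧ q.Prime ∧ p ∣ n ∧ q ∣ n ∧
          (q ∣ p - 1 ∨ (q ∣ p + 1 ∧ p ^ 2 ∣ n))] := by
  tfae_have 1 → 3 := by
    intro h G _ hG k
    have : Finite G := Nat.finite_of_card_ne_zero (by omega)
    exact canBeIntegrated_of_comm G (h G hG) k
  tfae_have 3 → 2 := fun h G _ hG => h G hG 2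
  tfae_have 2 → 4 := by
    intro h
    by_contra hd
    obtain ⟨G, _, hG, g, hg⟩ := exists_group_conj_notMem_derivedSeries hn.ne' hd
    obtain ⟨H, _, ⟨e⟩⟩ := h (ULift.{u} G) (by rw [Nat.card_ulift, hG])
    exact hg (conj_mem_derivedSeries_mulAut (e.trans MulEquiv.ulift) g)
  tfae_have 4 → 1 := fun h G _ hG => mul_comm_of_card_cubeFree hn h.1 h.2 hG
  tfae_finish
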